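/- **Theorem.** Equip $[0,1]$ with the partial sum $r\oplus s=r+s$ (defined iff $r+s\le 1$), the orthocomplement $r^\bot=1-r$ and the multiplication action of $[0,1]$; this makes it an effect module, and so is $[0,1]^X$, with the pointwise structure, for every set $X$. (An *effect algebra* is a partial commutative monoid $(E,\oplus,0)$ with an operation $(-)^\bot$ such that, with $1=0^\bot$, the element $x^\bot$ is the unique one with $x\oplus x^\bot=1$, and $x\oplus 1$ is defined iff $x=0$. An *effect module* is an effect algebra with an action of the monoid $([0,1],\cdot,1)$ that preserves existing sums in each of its two variables. Morphisms preserve all this structure; $\mathbf{EMod}$ is the category of effect modules.) Let $\mathcal{E}$ be the *expectation monad* on $\mathbf{Set}$, that is, the monad induced by the dual adjunction $$\mathbf{Set}(-,[0,1])\dashv \mathbf{EMod}(-,[0,1])\colon \mathbf{EMod}^{\mathrm{op}}\to\mathbf{Set},$$ so that $\mathcal{E}X=\mathbf{EMod}([0,1]^X,[0,1])$. Let $\mathcal{D}_{\mathsf f}$ be the finite distribution monad on $\mathbf{Set}$, where $\mathcal{D}_{\mathsf f}X$ is the set of finitely supported probability distributions on $X$; let $\mathbf{Kl}_{\mathsf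 f}(\mathcal{D}_{\mathsf f})$ be the full subcategory of its Kleisli category on the finite sets, and let $U_{\mathcal{D}_{\mathsf f}}\colon \mathbf{Kl}_{\mathsf f}(\mathcal{D}_{\mathsf f})\to\mathbf{Set}$ be the forgetful functor, which sends $X$ to $\mathcal{D}_{\mathsf f}X$ and $f\colon X\to\mathcal{D}_{\mathsf f}Y$ to its Kleisli extension $\mathcal{D}_{\mathsf f}X\to\mathcal{D}_{\mathsf f}Y$. Then $\mathcal{E}$ is the codensity monad of $U=U_{\mathcal{D}_{\mathsf f}}$: the right Kan extension $\mathrm{Ran}_U U$ exists and is pointwise, and the codensity monad $(\mathrm{Ran}_U U,\eta,\mu)$ is isomorphic to $\mathcal{E}$ as a monad. (Here, with $\varphi\colon(\mathrm{Ran}_U U)U\to U$ the counit, $\eta$ and $\mu$ correspond under the universal property of $\mathrm{Ran}_U U$ to $\mathrm{id}_U$ and to $\varphi\cdot(\mathrm{Ran}_U U)\varphi$.) -/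

import Mathlib

open CategoryTheory

universe u v w v₁ u₁ v₂ u₂

/-! ### Codensity monads -/

namespace Codensity

noncomputable section

variable {A : Type u₁} {C : Type u₂} [Category.{v₁} A] [Category.{v₂} C]
  (F : A ⥤ C) [F.HasRightKanExtension F]

/-- The underlying endofunctor `Ran_F F` of the codensity monad. -/
abbrev ran : C ⥤ C := F.rightKanExtension F

/-- The counit `φ : (Ran_F F) F ⟶ F`. -/
abbrev counit : F ⋙ ran F ⟶ F := F.rightKanExtensionCounit F

/-- The unit: the transformation `𝟭 ⟶ Ran_F F` that corresponds to `𝟙 : F ⟶ F`. -/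
def unit : 𝟭 C ⟶ ran F :=
  (ran F).liftOfIsRightKanExtension (counit F) (𝟭 C) F.rightUnitor.hom

/-- The multiplication: the transformation `(Ran_F F)(Ran_F F) ⟶ Ran_F F` that corresponds to
`(Ran_F F)(Ran_F F) F ⟶ (Ran_F F) F ⟶ F`, the composite of `(Ran_F F) φ` and `φ`. -/
def mult : ran F ⋙ ran F ⟶ ran F :=
  (ran F).liftOfIsRightKanExtension (counit F) (ran F ⋙ ran F)
    ((F.associator (ran F) (ran F)).inv ≫ Functor.whiskerRight (counit F) (ran F) ≫ counit F)

lemma unit_counit (X : A) :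
    (unit F).app (F.obj X) ≫ (counit F).app X = 𝟙 (F.obj X) := by
  exact (ran F).liftOfIsRightKanExtension_fac_app (counit F) (𝟭 C) F.rightUnitor.hom X

lemma mult_counit (X : A) :
    (mult F).app (F.obj X) ≫ (counit F).app X =
      (ran F).map ((counit F).app X) ≫ (counit F).app X := by
  have h := (ran F).liftOfIsRightKanExtension_fac_app (counit F) (ran F ⋙ ran F)
    ((F.associator (ran F) (ran F)).inv ≫ Functor.whiskerRight (counit F) (ran F) ≫ counit F) X
  simp only [NatTrans.comp_app, Functor.associator_inv_app, Functor.whiskerRight_app] at h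
  exact h.trans (Category.id_comp _)

lemma ran_hom_ext {G : C ⥤ C} (α β : G ⟶ ran F)
    (h : ∀ X, α.app (F.obj X) ≫ (counit F).app X = β.app (F.obj X) ≫ (counit F).app X) :
    α = β := by
  apply F.rightKanExtension_hom_ext F
  ext X
  exact h X

/-- The codensity monad `(Ran_F F, η, μ)` of a functor `F` whose right Kan extension along itself
exists. -/
def monad : Monad C where
  toFunctor := ran F
  η := unit F
  μ := mult F
  assoc X := by
    have h := ran_hom_ext F
      (Functor.whiskerRight (mult F) (ran F) ≫ mult F)
      ((Functor.associator _ _ _).hom ≫ Functor.whiskerLeft (ran F) (mult F) ≫ mult F) (by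
        intro X
        have e := (mult F).naturality ((counit F).app X)
        simp only [Functor.comp_map] at e
        simp only [NatTrans.comp_app, Functor.whiskerRight_app, Functor.whiskerLeft_app,
          Functor.associator_hom_app, Category.assoc, Category.id_comp, mult_counit]
        rw [← Functor.map_comp_assoc, mult_counit, Functor.map_comp_assoc, ← reassoc_of% e,
          mult_counit])
    simpa using! NatTrans.congr_app h X
  left_unit X := by
    have h := ran_hom_ext F
      (Functor.whiskerLeft (ran F) (unit F) ≫ mult F) (ran F).rightUnitor.hom (by
        intro X
        have e := (unit F).naturality ((counit F).app X)
        simp only [Functor.id_map] at e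
        simp only [NatTrans.comp_app, Functor.whiskerLeft_app, Category.assoc, mult_counit]
        erw [← reassoc_of% e, unit_counit]
        simp)
    simpa using! NatTrans.congr_app h X
  right_unit X := by
    have h := ran_hom_ext F
      (Functor.whiskerRight (unit F) (ran F) ≫ mult F) (ran F).leftUnitor.hom (by
        intro X
        simp only [NatTrans.comp_app, Functor.whiskerRight_app, Category.assoc, mult_counit]
        rw [← Functor.map_comp_assoc, unit_counit]
        simp)
    simpa using! NatTrans.congr_app h X

end

end Codensity

/-! ### Effect algebras and effect modules -/

/-- An effect algebra. The partial operation `⊕` is given by its graph: `IsSum a b c` says that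
`a ⊕ b` is defined and equal to `c`. The top element is `1 = 0ᗮ`, that is `orth zero`. -/
class EffectAlgebra (E : Type u) where
  IsSum : E → E → E → Prop
  zero : E
  orth : E → E
  /-- The operation is single-valued. -/
  isSum_unique : ∀ {a b c c'}, IsSum a b c → IsSum a b c' → c = c'
  isSum_comm : ∀ {a b c}, IsSum a b c → IsSum b a c
  /-- If `(a ⊕ b) ⊕ c` is defined, then so is `a ⊕ (b ⊕ c)`, and they agree. -/
  isSum_assoc : ∀ {a b c d e}, IsSum a b d → IsSum d c e → ∃ f, IsSum b c f ∧ IsSum a f e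
  zero_isSum : ∀ a, IsSum zero a a
  /-- `aᗮ` is the unique element with `a ⊕ aᗮ = 1`. -/
  isSum_one_iff : ∀ {a b}, IsSum a b (orth zero) ↔ b = orth a
  /-- `a ⊕ 1` is defined iff `a = 0`. -/
  exists_isSum_one_iff : ∀ {a}, (∃ c, IsSum a (orth zero) c) ↔ a = zero

/-- The effect algebra `[0,1]`: `r ⊕ s = r + s`, defined if `r + s ≤ 1`, and `rᗮ = 1 - r`. -/
instance unitInterval.effectAlgebra : EffectAlgebra unitInterval where
  IsSum r s t := (r : ℝ) + s = t
  zero := 0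
  orth r := unitInterval.symm r
  isSum_unique h h' := Subtype.ext (h.symm.trans h')
  isSum_comm h := by rw [add_comm]; exact h
  isSum_assoc {a b c d e} h h' := by
    have ha := a.2.1
    have hb := b.2.1
    have hc := c.2.1
    have he := e.2.2
    exact ⟨⟨(b : ℝ) + c, by positivity, by linarith⟩, rfl, by simp only; linarith⟩
  zero_isSum a := by simp
  isSum_one_iff {a b} := by
    rw [Subtype.ext_iff]
    simp only [unitInterval.symm_zero, unitInterval.coe_symm_eq, Set.Icc.coe_one]
    constructor <;> intro h <;> linarith
  exists_isSum_one_iff {a} := by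
    rw [Subtype.ext_iff]
    simp only [unitInterval.symm_zero, Set.Icc.coe_one, Set.Icc.coe_zero]
    constructor
    · rintro ⟨c, hc⟩
      linarith [a.2.1, c.2.2]
    · intro h
      exact ⟨1, by simp [h]⟩

/-- An effect module: an effect algebra with an action of the monoid `[0,1]` that is additive in
both variables. -/
class EffectModule (E : Type u) extends EffectAlgebra E where
  act : unitInterval → E → E
  one_act : ∀ a, act 1 a = a
  mul_act : ∀ r s a, act (r * s) a = act r (act s a)
  act_isSum : ∀ r {a b c}, IsSum a b c → IsSum (act r a) (act r b) (act r c)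
  isSum_act : ∀ {r s t : unitInterval} (a), EffectAlgebra.IsSum r s t →
    IsSum (act r a) (act s a) (act t a)

/-- `[0,1]` as an effect module, acting on itself by multiplication. -/
instance unitInterval.effectModule : EffectModule unitInterval where
  act r s := r * s
  one_act := one_mul
  mul_act := mul_assoc
  act_isSum r {a b c} h := by
    change ((r * a : unitInterval) : ℝ) + (r * b : unitInterval) = (r * c : unitInterval)
    change (a : ℝ) + b = c at h
    simp [← h, mul_add]
  isSum_act {r s t} a h := by
    change ((r * a : unitInterval) : ℝ) + (s * a : unitInterval) = (t * a : unitInterval)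
    change (r : ℝ) + s = t at h
    simp [← h, add_mul]

/-- The effect module `[0,1]^X` with the pointwise structure. -/
instance unitInterval.powerEffectModule (X : Type u) : EffectModule (X → unitInterval) where
  IsSum f g h := ∀ x, EffectAlgebra.IsSum (f x) (g x) (h x)
  zero := fun _ => EffectAlgebra.zero
  orth f := fun x => EffectAlgebra.orth (f x)
  isSum_unique h h' := funext fun x => EffectAlgebra.isSum_unique (h x) (h' x)
  isSum_comm h := fun x => EffectAlgebra.isSum_comm (h x)
  isSum_assoc h h' := by
    choose f hf using fun x => EffectAlgebra.isSum_assoc (h x) (h' x)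
    exact ⟨f, fun x => (hf x).1, fun x => (hf x).2⟩
  zero_isSum f := fun x => EffectAlgebra.zero_isSum (f x)
  isSum_one_iff := by
    intro f g
    rw [funext_iff]
    exact forall_congr' fun x => EffectAlgebra.isSum_one_iff
  exists_isSum_one_iff := by
    intro f
    rw [funext_iff, ← Classical.skolem]
    exact forall_congr' fun x => EffectAlgebra.exists_isSum_one_iff
  act r f := fun x => EffectModule.act r (f x)
  one_act f := funext fun x => EffectModule.one_act (f x)
  mul_act r s f := funext fun x => EffectModule.mul_act r s (f x)
  act_isSum r _ _ _ h := fun x => EffectModule.act_isSum r (h x)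
  isSum_act f h := fun x => EffectModule.isSum_act (f x) h

/-- Morphisms of effect modules: maps that preserve the effect algebra structure and the action. -/
@[ext]
structure EffectModuleHom (E : Type u) (E' : Type v) [EffectModule E] [EffectModule E'] where
  toFun : E → E'
  map_isSum : ∀ {a b c : E}, EffectAlgebra.IsSum a b c →
    EffectAlgebra.IsSum (toFun a) (toFun b) (toFun c)
  map_zero : toFun EffectAlgebra.zero = EffectAlgebra.zero
  map_orth : ∀ a, toFun (EffectAlgebra.orth a) = EffectAlgebra.orth (toFun a)
  map_act : ∀ r a, toFun (EffectModule.act r a) = EffectModule.act r (toFun a)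

namespace EffectModuleHom

/-- The identity morphism. -/
def id (E : Type u) [EffectModule E] : EffectModuleHom E E where
  toFun a := a
  map_isSum h := h
  map_zero := rfl
  map_orth _ := rfl
  map_act _ _ := rfl

/-- Composition `g ∘ f` of morphisms. -/
def comp {E : Type u} {E' : Type v} {E'' : Type w}
    [EffectModule E] [EffectModule E'] [EffectModule E'']
    (g : EffectModuleHom E' E'') (f : EffectModuleHom E E') : EffectModuleHom E E'' where
  toFun a := g.toFun (f.toFun a)
  map_isSum h := g.map_isSum (f.map_isSum h)
  map_zero := by rw [f.map_zero, g.map_zero]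
  map_orth a := by rw [f.map_orth, g.map_orth]
  map_act r a := by rw [f.map_act, g.map_act]

/-- Precomposition with `h : X → Y`, as a morphism `[0,1]^Y → [0,1]^X`. -/
def precomp {X : Type u} {Y : Type v} (h : X → Y) :
    EffectModuleHom (Y → unitInterval) (X → unitInterval) where
  toFun f := fun x => f (h x)
  map_isSum hf := fun x => hf (h x)
  map_zero := rfl
  map_orth _ := rfl
  map_act _ _ := rfl

/-- Evaluation at a point `x`, as a morphism `[0,1]^X → [0,1]`. -/
def eval {X : Type u} (x : X) : EffectModuleHom (X → unitInterval) unitInterval where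
  toFun f := f x
  map_isSum h := h x
  map_zero := rfl
  map_orth _ := rfl
  map_act _ _ := rfl

/-- The morphism `E → [0,1]^X` whose components are the morphisms `p x : E → [0,1]`. -/
def pi {E : Type u} [EffectModule E] {X : Type v} (p : X → EffectModuleHom E unitInterval) :
    EffectModuleHom E (X → unitInterval) where
  toFun a := fun x => (p x).toFun a
  map_isSum h := fun x => (p x).map_isSum h
  map_zero := funext fun x => (p x).map_zero
  map_orth a := funext fun x => (p x).map_orth a
  map_act r a := funext fun x => (p x).map_act r a

end EffectModuleHom

/-- The category of effect modules. -/
structure EMod : Type (u + 1) where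
  carrier : Type u
  [str : EffectModule carrier]

attribute [instance] EMod.str

instance EMod.category : Category.{u} EMod.{u} where
  Hom E E' := EffectModuleHom E.carrier E'.carrier
  id E := EffectModuleHom.id E.carrier
  comp f g := EffectModuleHom.comp g f

/-! ### The expectation monad -/

namespace Expectation

/-- The functor `Set(-,[0,1]) : Set ⥤ EModᵒᵖ`. -/
def predicates : Type u ⥤ EMod.{u}ᵒᵖ where
  obj X := Opposite.op (EMod.mk (X → unitInterval))
  map h := Quiver.Hom.op (V := EMod.{u}) (EffectModuleHom.precomp h)

/-- The functor `EMod(-,[0,1]) : EModᵒᵖ ⥤ Set`. -/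
def states : EMod.{u}ᵒᵖ ⥤ Type u where
  obj E := EffectModuleHom E.unop.carrier unitInterval
  map f := ↾fun p => EffectModuleHom.comp p f.unop

/-- The dual adjunction `Set(-,[0,1]) ⊣ EMod(-,[0,1])`, given by transposing a map `E × X → [0,1]`
that is an effect module morphism in the first variable. -/
def adjunction : predicates.{u} ⊣ states.{u} :=
  Adjunction.mkOfHomEquiv
    { homEquiv := fun _ _ =>
        { toFun := fun f => ↾fun x => EffectModuleHom.comp (EffectModuleHom.eval x) f.unop
          invFun := fun p => Quiver.Hom.op (V := EMod.{u}) (EffectModuleHom.pi p)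
          left_inv := fun _ => rfl
          right_inv := fun _ => rfl }
      homEquiv_naturality_left_symm := fun _ _ => rfl
      homEquiv_naturality_right := fun _ _ => rfl }

/-- The expectation monad `X ↦ EMod([0,1]^X,[0,1])` on `Set`, induced by the dual adjunction. -/
def monad : Monad (Type u) := adjunction.{u}.toMonad

end Expectation

/-! ### The finite distribution monad -/

namespace FiniteDistribution

open Convexity

noncomputable section

/-- The monad `D_f` on `Set` of finitely supported probability distributions: the unit is given by
the point masses and the multiplication by averaging, `(μ P)(x) = ∑ p, P(p) p(x)`. -/
def monad : Monad (Type u) where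
  obj X := StdSimplex ℝ X
  map h := ↾(StdSimplex.map h)
  map_id X := by
    refine ConcreteCategory.hom_ext _ _ fun p => ?_
    exact StdSimplex.map_id p
  map_comp f g := by
    refine ConcreteCategory.hom_ext _ _ fun p => ?_
    exact StdSimplex.map_comp p f g
  η :=
    { app := fun X => ↾(fun x : X => StdSimplex.single (R := ℝ) x)
      naturality := fun X Y f => by
        refine ConcreteCategory.hom_ext _ _ fun x => ?_
        exact (StdSimplex.map_single x f).symm }
  μ :=
    { app := fun X => ↾(fun P : StdSimplex ℝ (StdSimplex ℝ X) => P.join)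
      naturality := fun X Y f => by
        refine ConcreteCategory.hom_ext _ _ fun P => ?_
        exact (StdSimplex.map_sConvexComb P f).symm }
  assoc X := by
    refine ConcreteCategory.hom_ext _ _ fun P => ?_
    have h (Q : StdSimplex ℝ (StdSimplex ℝ (StdSimplex ℝ X))) :
        (Q.map StdSimplex.join).join = Q.join.join := (sConvexComb_sConvexComb Q).symm
    exact h P
  left_unit X := by
    refine ConcreteCategory.hom_ext _ _ fun p => ?_
    have h (q : StdSimplex ℝ X) : (StdSimplex.single (R := ℝ) q).join = q := by
      ext : 1
      simp
    exact h p
  right_unit X := by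
    refine ConcreteCategory.hom_ext _ _ fun p => ?_
    change StdSimplex.join (StdSimplex.map (fun x : X => StdSimplex.single (R := ℝ) x) p) = p
    ext : 1
    rw [StdSimplex.weights_join, StdSimplex.weights_map, Finsupp.sum_mapDomain_index
      (by simp) (by intros; rw [add_smul])]
    simp

/-- `Kl_f(D_f)`: the full subcategory of the Kleisli category of `D_f` on the finite sets. -/
abbrev FinKleisli : Type (u + 1) :=
  ObjectProperty.FullSubcategory (C := Kleisli monad.{u}) fun X => Finite X.of

/-- The forgetful functor `U : Kl_f(D_f) ⥤ Set`, sending `X` to `D_f X` and `f : X → D_f Y` to its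
Kleisli extension `D_f X → D_f Y`. -/
def forgetful : FinKleisli.{u} ⥤ Type u :=
  ObjectProperty.ι _ ⋙ Kleisli.Adjunction.fromKleisli monad.{u}

end

end FiniteDistribution

/-! ### Finite sums in effect modules of predicates -/

namespace EffectModuleHom

/-! The pointwise right Kan extension at `Y` is the limit of `D_f X` over all maps `Y → D_f X` with
`X` finite, so its elements are the compatible families. Since `D_f 2 ≅ [0,1]`, the component at the
two-element set is a map `[0,1]^Y → [0,1]`. Compatibility with Kleisli maps into `2` makes it linear
in the sense of `coe_expect`, hence an effect module morphism; additivity uses a three-point set.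

Conversely, a morphism `p` on `[0,1]^Y` gives the family sending `h` to the barycenter of `p` pushed
forward along `h`. The two passages are inverse by `barycenter_toHom` and `hom_ext_of_barycenter`.

The counit is thus the barycenter map `E (D_f X) → D_f X`. It satisfies the Eilenberg–Moore laws
(`unit_expectationCounit`, `mult_expectationCounit`), and by the universal property these laws force
the monad structures to agree (`monadIso`). -/

lemma map_const_zero {Z : Type u} (p : EffectModuleHom (Z → unitInterval) unitInterval) :
    p.toFun (fun _ => 0) = 0 :=
  p.map_zero

lemma map_const_one {Z : Type u} (p : EffectModuleHom (Z → unitInterval) unitInterval) :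
    p.toFun (fun _ => 1) = 1 := by
  have h : p.toFun (fun _ => unitInterval.symm 0) = unitInterval.symm (p.toFun fun _ => 0) :=
    p.map_orth fun _ => 0
  simpa [map_const_zero] using h

lemma coe_map_sum {Z : Type u} {ι : Type v}
    (p : EffectModuleHom (Z → unitInterval) unitInterval) (s : Finset ι)
    (F : ι → Z → unitInterval) (H : Z → unitInterval)
    (hH : ∀ z, (H z : ℝ) = ∑ i ∈ s, (F i z : ℝ)) :
    (p.toFun H : ℝ) = ∑ i ∈ s, (p.toFun (F i) : ℝ) := by
  classical
  induction s using Finset.induction_on generalizing H with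
  | empty =>
    have : H = fun _ => 0 := funext fun z => Subtype.ext (by simpa using hH z)
    simp [this, map_const_zero]
  | insert a s ha ih =>
    simp only [Finset.sum_insert ha] at hH ⊢
    -- Only existing sums are preserved; the partial sum exists because it is bounded by `H z ≤ 1`.
    have hK (z : Z) : ∑ i ∈ s, (F i z : ℝ) ∈ unitInterval :=
      ⟨Finset.sum_nonneg fun i _ => (F i z).2.1, by linarith [hH z, (F a z).2.1, (H z).2.2]⟩
    rw [← ih (fun z => ⟨_, hK z⟩) fun _ => rfl]
    have h : EffectAlgebra.IsSum (F a) (fun z => ⟨_, hK z⟩) H := fun z => (hH z).symm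
    exact (p.map_isSum h).symm

end EffectModuleHom

/-! ### Distributions on finite sets -/

namespace FiniteDistribution

open Convexity

noncomputable section

/-- The Kleisli extension of a map `k : X → D_f Y`. -/
def bind {X : Type u} {Y : Type v} (k : X → StdSimplex ℝ Y) (q : StdSimplex ℝ X) :
    StdSimplex ℝ Y :=
  (q.map k).join

lemma weights_bind {X : Type u} {Y : Type v} [Fintype X] (k : X → StdSimplex ℝ Y)
    (q : StdSimplex ℝ X) (y : Y) :
    (bind k q).weights y = ∑ x, q.weights x * (k x).weights y := by
  rw [bind, StdSimplex.weights_join, StdSimplex.weights_map, Finsupp.sum_mapDomain_index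
    (by simp) (by intros; rw [add_smul]), Finsupp.sum_fintype _ _ (by simp)]
  simp [Finsupp.finsetSum_apply]

lemma sum_weights {X : Type u} [Fintype X] (q : StdSimplex ℝ X) : ∑ x, q.weights x = 1 := by
  rw [← q.total, Finsupp.sum_fintype _ _ (by simp)]

/-- The distribution on a finite set with the given weights. -/
def ofWeights {X : Type u} [Fintype X] (w : X → ℝ) (h₀ : ∀ x, 0 ≤ w x) (h₁ : ∑ x, w x = 1) :
    StdSimplex ℝ X where
  weights := Finsupp.equivFunOnFinite.symm w
  nonneg := fun x => by simpa using h₀ x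
  total := by rw [Finsupp.sum_fintype _ _ (by simp)]; simpa using h₁

@[simp]
lemma weights_ofWeights {X : Type u} [Fintype X] (w : X → ℝ) (h₀ h₁) (x : X) :
    (ofWeights w h₀ h₁).weights x = w x := by
  simp [ofWeights]

/-- The predicate `q ↦ q(x)` on `D_f X`. -/
def weightAt {X : Type u} (x : X) (q : StdSimplex ℝ X) : unitInterval :=
  ⟨q.weights x, q.weights_nonneg x, by
    classical
    by_cases hx : x ∈ q.weights.support
    · rw [← q.total]
      exact Finset.single_le_sum (f := fun x => q.weights x) (fun i _ => q.weights_nonneg i) hx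
    · rw [Finsupp.notMem_support_iff.1 hx]
      exact zero_le_one⟩

@[simp]
lemma coe_weightAt {X : Type u} (x : X) (q : StdSimplex ℝ X) :
    (weightAt x q : ℝ) = q.weights x := rfl

/-- The distribution on `X` that gives `x` the expectation of the predicate `q ↦ q(x)`. -/
def barycenter {X : Type u} [Finite X]
    (p : EffectModuleHom (StdSimplex ℝ X → unitInterval) unitInterval) : StdSimplex ℝ X :=
  letI := Fintype.ofFinite X
  ofWeights (fun x => (p.toFun (weightAt x) : ℝ)) (fun x => (p.toFun (weightAt x)).2.1) (by
    rw [← p.coe_map_sum Finset.univ weightAt (fun _ => 1) fun q => by simp [sum_weights],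
      p.map_const_one]
    simp)

@[simp]
lemma weights_barycenter {X : Type u} [Finite X]
    (p : EffectModuleHom (StdSimplex ℝ X → unitInterval) unitInterval) (x : X) :
    (barycenter p).weights x = p.toFun (weightAt x) := by
  simp [barycenter]

/-- Kleisli extensions are affine, so they commute with barycenters. -/
lemma barycenter_precomp_bind {X : Type u} {Y : Type v} [Finite X] [Finite Y] (k : X → StdSimplex ℝ Y)
    (p : EffectModuleHom (StdSimplex ℝ X → unitInterval) unitInterval) :
    barycenter (p.comp (EffectModuleHom.precomp (bind k))) = bind k (barycenter p) := by
  have := Fintype.ofFinite X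
  ext y
  rw [weights_barycenter, weights_bind]
  -- The weight of `bind k q` at `y` is a sum over `x` of the scalars `k(x)(y)` times the predicates
  -- `q ↦ q(x)`, and `p` preserves such sums.
  refine (p.coe_map_sum Finset.univ (fun x q => weightAt y (k x) * weightAt x q) _
    fun q => ?_).trans ?_
  · simp [EffectModuleHom.precomp, weights_bind, mul_comm]
  · refine Finset.sum_congr rfl fun x _ => ?_
    have h : p.toFun (fun q => weightAt y (k x) * weightAt x q) =
        weightAt y (k x) * p.toFun (weightAt x) := p.map_act _ _
    rw [h]
    simp [mul_comm]

/-- The distribution on the two-element set with weight `r` at `true`. -/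
def coin (r : unitInterval) : StdSimplex ℝ (ULift.{u} Bool) :=
  ofWeights (fun b => cond b.down (r : ℝ) (1 - r))
    (by rintro ⟨_ | _⟩ <;> simp [r.2.1, r.2.2])
    (by rw [← Equiv.ulift.symm.sum_comp]; simp)

@[simp]
lemma weights_coin (r : unitInterval) (b : Bool) :
    (coin.{u} r).weights ⟨b⟩ = cond b (r : ℝ) (1 - r) := by
  simp [coin]

lemma sum_ulift_bool (f : ULift.{u} Bool → ℝ) : ∑ b, f b = f ⟨true⟩ + f ⟨false⟩ := by
  rw [← Equiv.ulift.symm.sum_comp]; simp [Equiv.ulift]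

lemma weights_false (q : StdSimplex ℝ (ULift.{u} Bool)) :
    q.weights ⟨false⟩ = 1 - q.weights ⟨true⟩ := by
  rw [← sum_weights q, sum_ulift_bool]; ring

lemma eq_coin {q : StdSimplex ℝ (ULift.{u} Bool)} {r : unitInterval}
    (h : q.weights ⟨true⟩ = r) : q = coin r := by
  ext ⟨_ | _⟩ <;> simp [weights_false, h]

/-- A family of distributions on the finite sets `X`, one for each map `Y → D_f X`, that is
compatible with Kleisli extensions. -/
structure CompatibleFamily (Y : Type u) where
  val : ∀ (X : Type u) [Finite X], (Y → StdSimplex ℝ X) → StdSimplex ℝ X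
  bind_val : ∀ (X X' : Type u) [Finite X] [Finite X'] (h : Y → StdSimplex ℝ X)
    (k : X → StdSimplex ℝ X'), val X' (fun y => bind k (h y)) = bind k (val X h)

namespace CompatibleFamily

variable {Y : Type u} (σ : CompatibleFamily Y)

/-- The expectation of a predicate under a compatible family. -/
def expect (f : Y → unitInterval) : unitInterval :=
  weightAt ⟨true⟩ (σ.val (ULift.{u} Bool) fun y => coin (f y))

/-- Tossing the coin `c x` after drawing `x` from `h y` gives the coin `f y`, so compatibility along
`x ↦ coin (c x)` computes the expectation of `f` from the single distribution `σ.val X h`. All the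
algebraic laws below are instances. -/
lemma coe_expect {X : Type u} [Fintype X] (h : Y → StdSimplex ℝ X) (c : X → unitInterval)
    {f : Y → unitInterval} (hf : ∀ y, (f y : ℝ) = ∑ x, (h y).weights x * c x) :
    (σ.expect f : ℝ) = ∑ x, (σ.val X h).weights x * c x := by
  have e : (fun y => coin.{u} (f y)) = fun y => bind (fun x => coin (c x)) (h y) :=
    funext fun y => (eq_coin (by simp [weights_bind, hf])).symm
  rw [expect, e, σ.bind_val]
  simp [weights_bind]

lemma expect_weightAt {X : Type u} [Finite X] (h : Y → StdSimplex ℝ X) (x : X) :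
    (σ.expect (fun y => weightAt x (h y)) : ℝ) = (σ.val X h).weights x := by
  classical
  have := Fintype.ofFinite X
  -- The weight at `x` is the mean of the indicator of `x`.
  rw [σ.coe_expect h (fun x' => if x' = x then 1 else 0) fun y => by simp [apply_ite]]
  simp [apply_ite]

lemma expect_isSum {f g h : Y → unitInterval} (H : ∀ y, (f y : ℝ) + g y = h y) :
    (σ.expect f : ℝ) + σ.expect g = σ.expect h := by
  have sum_three (w : ULift.{u} (Fin 3) → ℝ) : ∑ i, w i = w ⟨0⟩ + w ⟨1⟩ + w ⟨2⟩ := by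
    rw [← Equiv.ulift.symm.sum_comp]; simp [Equiv.ulift, Fin.sum_univ_three]
  -- One distribution with weights `f`, `g` and the remainder `1 - h` has all three predicates as
  -- means, with coefficients `(1,0,0)`, `(0,1,0)` and `(1,1,0)`.
  let t (y : Y) : StdSimplex ℝ (ULift.{u} (Fin 3)) :=
    ofWeights (fun i => ![(f y : ℝ), g y, 1 - h y] i.down)
      (by rintro ⟨i⟩; fin_cases i <;> simp [(f y).2.1, (g y).2.1, (h y).2.2])
      (by rw [sum_three]; simp [← H])
  rw [σ.coe_expect t (fun i => ![1, 0, 0] i.down) (fun y => by simp [sum_three, t]),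
    σ.coe_expect t (fun i => ![0, 1, 0] i.down) fun y => by simp [sum_three, t],
    σ.coe_expect t (fun i => ![1, 1, 0] i.down) fun y => by simp [sum_three, t, ← H]]
  simp [sum_three]

lemma expect_zero : σ.expect (fun _ => 0) = 0 := by
  -- From `0 + 0 = 0`, the value `a` satisfies `a + a = a`.
  have h := σ.expect_isSum (f := fun _ => 0) (g := fun _ => 0) (h := fun _ => 0) (by simp)
  exact Subtype.ext (by simpa using h)

lemma expect_symm (f : Y → unitInterval) :
    σ.expect (fun y => unitInterval.symm (f y)) = unitInterval.symm (σ.expect f) := by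
  refine Subtype.ext ?_
  rw [σ.coe_expect (fun y => coin (f y)) (fun b => cond b.down 0 1)
    fun y => by simp [sum_ulift_bool]]
  simp [sum_ulift_bool, weights_false, expect]

lemma expect_mul (r : unitInterval) (f : Y → unitInterval) :
    σ.expect (fun y => r * f y) = r * σ.expect f := by
  refine Subtype.ext ?_
  rw [σ.coe_expect (fun y => coin (f y)) (fun b => cond b.down r 0)
    fun y => by simp [sum_ulift_bool, mul_comm]]
  simp [sum_ulift_bool, expect, mul_comm]

/-- The effect module morphism given by a compatible family. -/
def toHom : EffectModuleHom (Y → unitInterval) unitInterval where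
  toFun := σ.expect
  map_isSum h := σ.expect_isSum h
  map_zero := σ.expect_zero
  map_orth f := σ.expect_symm f
  map_act r f := σ.expect_mul r f

lemma barycenter_toHom {X : Type u} [Finite X] (h : Y → StdSimplex ℝ X) :
    barycenter (σ.toHom.comp (EffectModuleHom.precomp h)) = σ.val X h := by
  ext x
  rw [weights_barycenter]
  exact σ.expect_weightAt h x

end CompatibleFamily

/-- Every predicate `f` is the weight at `true` of `coin ∘ f`, so two-valued tests already determine
a morphism. -/
lemma hom_ext_of_barycenter {Y : Type u}
    {p p' : EffectModuleHom (Y → unitInterval) unitInterval}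
    (H : ∀ h : Y → StdSimplex ℝ (ULift.{u} Bool),
      barycenter (p.comp (EffectModuleHom.precomp h)) =
        barycenter (p'.comp (EffectModuleHom.precomp h))) : p = p' := by
  ext f
  have h := congrArg (fun q => q.weights ⟨true⟩) (H fun y => coin (f y))
  have e : (fun y => weightAt ⟨true⟩ (coin.{u} (f y))) = f := funext fun y => by
    ext; simp
  simp only [weights_barycenter, EffectModuleHom.comp, EffectModuleHom.precomp, e] at h
  exact h

end

end FiniteDistribution

/-! ### Monads that are right Kan extensions -/

namespace Codensity

noncomputable section

/-- A monad `T` whose underlying endofunctor is a right Kan extension of `F` along itself, with a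
counit that is compatible with the unit and the multiplication, is the codensity monad of `F`. -/
def monadIso {A : Type u₁} {C : Type u₂} [Category.{v₁} A] [Category.{v₂} C] (F : A ⥤ C)
    [F.HasRightKanExtension F] (T : Monad C) (φ : F ⋙ T.toFunctor ⟶ F)
    [T.toFunctor.IsRightKanExtension φ]
    (hη : ∀ X, T.η.app (F.obj X) ≫ φ.app X = 𝟙 (F.obj X))
    (hμ : ∀ X, T.μ.app (F.obj X) ≫ φ.app X = T.map (φ.app X) ≫ φ.app X) :
    T ≅ monad F :=
  let e : T.toFunctor ≅ ran F := T.toFunctor.rightKanExtensionUnique φ (ran F) (counit F)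
  have he (X : A) : e.hom.app (F.obj X) ≫ (counit F).app X = φ.app X := by
    simp [e]
  MonadIso.mk e
    (fun X => by
      refine NatTrans.congr_app (ran_hom_ext F (T.η ≫ e.hom) (unit F) fun X => ?_) X
      rw [unit_counit, NatTrans.comp_app, Category.assoc, he, hη])
    (fun X => by
      have h := NatTrans.congr_app (ran_hom_ext F (T.μ ≫ e.hom)
        (Functor.whiskerRight e.hom T.toFunctor ≫ Functor.whiskerLeft (ran F) e.hom ≫ mult F)
        fun X => ?_) X
      · exact h.trans (Category.assoc _ _ _).symm
      -- Naturality moves `e` past the counit, so that each of the two copies of `e` meets a counit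
      -- and turns it into `φ`.
      · have n := e.hom.naturality ((counit F).app X)
        simp only [NatTrans.comp_app, Functor.whiskerRight_app, Functor.whiskerLeft_app,
          Category.assoc, mult_counit, he, hμ]
        rw [← reassoc_of% n, he, ← Functor.map_comp_assoc, he])

end

end Codensity

/-! ### The expectation monad as a right Kan extension -/

namespace FiniteDistribution

open Convexity

noncomputable section

/-- The counit `E U ⟶ U`, given by barycenters. -/
def expectationCounit : forgetful.{u} ⋙ Expectation.monad.{u}.toFunctor ⟶ forgetful.{u} where
  app X := ↾fun p => haveI := X.property; barycenter (X := X.obj.of) p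
  naturality X Y k := by
    have := X.property
    have := Y.property
    refine ConcreteCategory.hom_ext _ _ fun p => ?_
    exact barycenter_precomp_bind (X := X.obj.of) (Y := Y.obj.of) k.hom.of p

/-- A finite set as an object of `Kl_f(D_f)`. -/
abbrev finKleisli (X : Type u) [Finite X] : FinKleisli.{u} :=
  ⟨Kleisli.mk _ X, ‹_›⟩

/-- The compatible family given by an element of a cone. -/
def familyOfCone {Y : Type u}
    (s : Limits.Cone (StructuredArrow.proj Y forgetful.{u} ⋙ forgetful.{u})) (a : s.pt) :
    CompatibleFamily Y where
  val X _ h := s.π.app (StructuredArrow.mk (Y := finKleisli X) (↾h)) a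
  bind_val X X' _ _ h k := by
    let f : finKleisli X ⟶ finKleisli X' := ObjectProperty.homMk ⟨↾k⟩
    -- A Kleisli map `k` is a morphism under `Y` from `h` to its composite with the extension of
    -- `k`; the cone condition there is exactly compatibility.
    let g : StructuredArrow.mk (S := Y) (T := forgetful) (Y := finKleisli X) (↾h) ⟶
        StructuredArrow.mk (S := Y) (T := forgetful) (Y := finKleisli X')
          (↾fun y => bind k (h y)) :=
      StructuredArrow.homMk f rfl
    exact ConcreteCategory.congr_hom (s.w g).symm a

/-- The expectation monad is a pointwise right Kan extension of `U` along itself. -/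
def isPointwiseRightKanExtension :
    (Functor.RightExtension.mk _ expectationCounit.{u}).IsPointwiseRightKanExtension := fun Y =>
  { lift := fun s => ↾fun a => (familyOfCone s a).toHom
    fac := fun s j => by
      refine ConcreteCategory.hom_ext _ _ fun a => ?_
      have := j.right.property
      exact (familyOfCone s a).barycenter_toHom (X := j.right.obj.of) j.hom
    uniq := fun s m hm => by
      refine ConcreteCategory.hom_ext _ _ fun a => ?_
      -- Uniqueness needs only the legs of the cone at the two-element set.
      refine hom_ext_of_barycenter fun h => ?_
      refine Eq.trans ?_ ((familyOfCone s a).barycenter_toHom h).symm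
      exact ConcreteCategory.congr_hom
        (hm (StructuredArrow.mk (Y := finKleisli (ULift.{u} Bool)) (↾h))) a }

lemma unit_expectationCounit (X : FinKleisli.{u}) :
    Expectation.monad.{u}.η.app (forgetful.obj X) ≫ expectationCounit.app X =
      𝟙 (forgetful.obj X) := by
  refine ConcreteCategory.hom_ext _ _ fun q => ?_
  have := X.property
  refine StdSimplex.ext (Finsupp.ext fun x => ?_)
  exact weights_barycenter (X := X.obj.of) _ x

/-- At `x`, both sides evaluate `P` on the same predicate: the weight at `x` of the barycenter of
`p` is by construction `p` applied to `weightAt x`. -/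
lemma mult_expectationCounit (X : FinKleisli.{u}) :
    Expectation.monad.{u}.μ.app (forgetful.obj X) ≫ expectationCounit.app X =
      Expectation.monad.{u}.map (expectationCounit.app X) ≫ expectationCounit.app X := by
  refine ConcreteCategory.hom_ext _ _ fun P => ?_
  have := X.property
  refine StdSimplex.ext (Finsupp.ext fun x => ?_)
  refine (weights_barycenter (X := X.obj.of) _ x).trans
    (Eq.trans ?_ (weights_barycenter (X := X.obj.of) _ x).symm)
  have e : (fun (p : EffectModuleHom (StdSimplex ℝ X.obj.of → unitInterval) unitInterval) =>
      weightAt x (barycenter (X := X.obj.of) p)) = fun p => p.toFun (weightAt x) :=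
    funext fun p => Subtype.ext (weights_barycenter (X := X.obj.of) p x)
  exact congrArg (fun f => ((EffectModuleHom.toFun P f : unitInterval) : ℝ)) e.symm

end

end FiniteDistribution

/-- The codensity monad of the forgetful functor `U : Kl_f(D_f) ⥤ Set` exists, is pointwise, and is
isomorphic, as a monad, to the expectation monad. -/
theorem theorem6p5 :
    FiniteDistribution.forgetful.{u}.HasPointwiseRightKanExtension
        FiniteDistribution.forgetful.{u} ∧
      ∃ _ : FiniteDistribution.forgetful.{u}.HasRightKanExtension FiniteDistribution.forgetful.{u},
        Nonempty (Expectation.monad.{u} ≅ Codensity.monad FiniteDistribution.forgetful.{u}) := by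
  have h := FiniteDistribution.isPointwiseRightKanExtension.{u}
  have : Expectation.monad.{u}.toFunctor.IsRightKanExtension
      FiniteDistribution.expectationCounit.{u} := h.isRightKanExtension
  have hR := h.hasRightKanExtension
  exact ⟨h.hasPointwiseRightKanExtension, hR, ⟨Codensity.monadIso _ _
    FiniteDistribution.expectationCounit.{u} FiniteDistribution.unit_expectationCounit
    FiniteDistribution.mult_expectationCounit⟩⟩
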